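/- **Theorem (Cauchy's integral formula).** Let $E$ be a locally complete locally convex Hausdorff space over $\mathbb{C}$, i.e. for every closed, bounded, absolutely convex set $D\subset E$ the space $E_D=\bigcup_{n\in\mathbb{N}} nD$, normed by the gauge functional of $D$, is a Banach space. Let $\Omega\subset\mathbb{C}^d$ be open, let $w\in\Omega$ and $R\in(0,\infty]^d$ be such that the polydisc $\mathbb{D}_R(w)=\{z\in\mathbb{C}^d : |z_k-w_k|<R_k,\ 1\le k\le d\}$ is contained in $\Omega$, and let $f\colon\Omega\to E$ be holomorphic, i.e. for every $z\in\Omega$ there is a $\mathbb{C}$-linear map $df(z)\colon\mathbb{C}^d\to\widehat{E}$ into the completion of $E$ with $$\lim_{u\to z,\ u\in\Omega\setminus\{z\}}\frac{f(u)-f(z)-df(z)[u-z]}{|u-z|}=0\quad\text{in }\widehat{E},$$ and $z\mapsto df(z)[v]$ is continuous from $\Omega$ to $\widehat{E}$ for every $v\in\mathbb{C}^d$. Then $f$ is infinitely complex partially differentiable on $\Omega$ with all iterated complex partial derivatives existing (as limits of difference quotients) in $E$, and for all $\rho\in(0,\infty)^d$ with $\rho_k<R_k$ for every $k$, all $\zeta\in\mathbb{D}_\rho(w)$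 and all $\beta\in\mathbb{N}_0^d$, $$\partial^\beta f(\zeta)=\frac{\beta!}{(2\pi i)^d}\int_{\partial_0\mathbb{D}_\rho(w)}\frac{f(z)}{(z-\zeta)^{\beta+(1,\dots,1)}}\,dz .$$ Here $\partial^\beta=\partial_{z_1}^{\beta_1}\cdots\partial_{z_d}^{\beta_d}$, $\beta!=\prod_k\beta_k!$, $(z-\zeta)^{\beta+(1,\dots,1)}=\prod_k(z_k-\zeta_k)^{\beta_k+1}$, and for $g$ defined on the distinguished boundary $\partial_0\mathbb{D}_\rho(w)=\{z : |z_k-w_k|=\rho_k,\ 1\le k\le d\}$, $$\int_{\partial_0\mathbb{D}_\rho(w)}g(z)\,dz=\int_{[0,2\pi]^d}g\bigl(w_1+\rho_1e^{it_1},\dots,w_d+\rho_de^{it_d}\bigr)\prod_{k=1}^d i\rho_ke^{it_k}\,dt$$ is the Pettis integral with respect to Lebesgue measure: the element $J\in E$ such that for every continuous linear functional $e'$ on $E$ the scalar function obtained by applying $e'$ to the integrand is Lebesgue integrable with integral $e'(J)$. The existence of this integral as an element of $E$ (not only of $\widehat{E}$) is part of the assertion. -/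

import Mathlib

open Set Filter Topology MeasureTheory
open scoped ENNReal Pointwise

namespace LCHolo

/-- `ℂᵈ` with the Euclidean norm. -/
abbrev Cd (d : ℕ) : Type := EuclideanSpace ℂ (Fin d)

/-- Scalar multiplication by a fixed complex number is uniformly continuous on a complex topological
vector space; this equips the completion of the space with its vector space structure. -/
instance instUniformContinuousConstSMulComplex (E : Type*) [AddCommGroup E] [Module ℂ E]
    [UniformSpace E] [IsUniformAddGroup E] [ContinuousSMul ℂ E] : UniformContinuousConstSMul ℂ E :=
  uniformContinuousConstSMul_of_continuousConstSMul ℂ E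

section LocallyComplete

variable {E : Type*} [AddCommGroup E] [Module ℂ E]

/-- A disk: a bounded, absolutely convex set. -/
def IsDisk [TopologicalSpace E] (D : Set E) : Prop :=
  Bornology.IsVonNBounded ℂ D ∧ Balanced ℂ D ∧ Convex ℝ D

/-- `E_D = ⋃ₙ n D`. -/
def diskSpan (D : Set E) : Set E := ⋃ n : ℕ, (n : ℝ) • D

/-- The space `E_D`, normed by the gauge functional of `D`, is complete: every sequence in `E_D`
which is Cauchy for the gauge of `D` converges to an element of `E_D` for the gauge of `D`. -/
def IsDiskComplete (D : Set E) : Prop :=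
  ∀ u : ℕ → E, (∀ n, u n ∈ diskSpan D) →
    (∀ ε : ℝ, 0 < ε → ∃ N, ∀ m, N ≤ m → ∀ n, N ≤ n → gauge D (u m - u n) < ε) →
    ∃ x ∈ diskSpan D, Tendsto (fun n => gauge D (u n - x)) atTop (𝓝 0)

/-- `E` is locally complete: `E_D` is a Banach space for every closed disk `D`. -/
def IsLocallyComplete (E : Type*) [AddCommGroup E] [Module ℂ E] [TopologicalSpace E] : Prop :=
  ∀ D : Set E, IsDisk D → IsClosed D → IsDiskComplete D

end LocallyComplete

section Differentiability

variable {d : ℕ} {E : Type*} [AddCommGroup E] [Module ℂ E]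

/-- `f` is holomorphic on `Ω`: at each point of `Ω` it has a `ℂ`-linear differential with values in
the completion of `E`, and the differential is pointwise continuous on `Ω`. -/
def IsHolomorphicOn [UniformSpace E] [IsUniformAddGroup E] [ContinuousSMul ℂ E]
    (f : Cd d → E) (Ω : Set (Cd d)) : Prop :=
  ∃ df : Cd d → (Cd d →ₗ[ℂ] UniformSpace.Completion E),
    (∀ z ∈ Ω, Tendsto
      (fun w => ((‖w - z‖ : ℂ))⁻¹ •
        ((f w : UniformSpace.Completion E) - (f z : UniformSpace.Completion E) - df z (w - z)))
      (𝓝[Ω \ {z}] z) (𝓝 0)) ∧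
    ∀ v : Cd d, ContinuousOn (fun z => df z v) Ω

/-- The difference quotient of `f` at `z` in the direction of the `j`-th unit vector. -/
noncomputable def diffQuot (f : Cd d → E) (j : Fin d) (z : Cd d) (h : ℂ) : E :=
  h⁻¹ • (f (z + h • EuclideanSpace.single j (1 : ℂ)) - f z)

variable [TopologicalSpace E]

/-- The `j`-th complex partial derivative `∂_{z_j} f`, the limit being taken in `E`. It is only
meaningful at points where this limit exists. -/
noncomputable def cpartial (j : Fin d) (f : Cd d → E) : Cd d → E := fun z =>
  haveI : Nonempty E := ⟨0⟩
  limUnder (𝓝[≠] (0 : ℂ)) (diffQuot f j z)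

/-- `f` is `k`-times complex partially differentiable on `Ω` with all partial derivatives in `E`. -/
def IsCPartialDiffOn : ℕ → (Cd d → E) → Set (Cd d) → Prop
  | 0, _, _ => True
  | k + 1, f, Ω => ∀ j : Fin d,
      (∀ z ∈ Ω, ∃ e : E, Tendsto (diffQuot f j z) (𝓝[≠] (0 : ℂ)) (𝓝 e)) ∧
        IsCPartialDiffOn k (cpartial j f) Ω

/-- `∂^β f = ∂₁^{β₁} ⋯ ∂_d^{β_d} f`. -/
noncomputable def iterCPartial (β : Fin d → ℕ) (f : Cd d → E) : Cd d → E :=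
  (List.finRange d).foldr (fun j g => (cpartial j)^[β j] g) f

end Differentiability

section Integration

variable {d : ℕ} {E : Type*} [AddCommGroup E] [Module ℂ E] [TopologicalSpace E]

/-- `g` is Pettis-integrable on `Λ ⊆ ℝᵈ` with respect to Lebesgue measure, with integral `e ∈ E`. -/
def HasPettisIntegralOn (g : (Fin d → ℝ) → E) (Λ : Set (Fin d → ℝ)) (e : E) : Prop :=
  ∀ e' : E →L[ℂ] ℂ, IntegrableOn (fun t => e' (g t)) Λ volume ∧ e' e = ∫ t in Λ, e' (g t)

/-- `∫_γ f(z) dz = e` as a Pettis integral over `[a,b]ᵈ`, where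
`γ(t₁, …, t_d) = (γ₁(t₁), …, γ_d(t_d))`. -/
def HasCurveIntegral (γ : Fin d → ℝ → ℂ) (a b : ℝ) (f : Cd d → E) (e : E) : Prop :=
  HasPettisIntegralOn
    (fun t => (∏ k, deriv (γ k) (t k)) • f (WithLp.toLp 2 (fun k => γ k (t k))))
    (Icc (fun _ => a) (fun _ => b)) e

/-- The polydisc `D_R(w)`, where the radii may be infinite. -/
def polydisc (w : Cd d) (R : Fin d → ℝ≥0∞) : Set (Cd d) := {z | ∀ k, edist (z k) (w k) < R k}

/-- `∫_{∂₀D_ρ(w)} f(z) dz = e`, the distinguished boundary being parametrised by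
`t ↦ (w_k + ρ_k e^{i t_k})_k`, `t ∈ [0,2π]ᵈ`. -/
def HasDistinguishedBoundaryIntegral (w : Cd d) (ρ : Fin d → ℝ) (f : Cd d → E) (e : E) : Prop :=
  HasCurveIntegral (fun k => circleMap (w k) (ρ k)) 0 (2 * Real.pi) f e

end Integration

end LCHolo

/-!
The proof reduces the vector-valued statement to complex-valued functions and never integrates in
`E`.

A holomorphic `f : Ω → E` is continuous, and every `e' ∘ f` with `e'` a continuous linear functional
is holomorphic, since `e'` extends to the completion of `E`. So `f` is weakly holomorphic and
bounded on compact sets (`IsHolomorphicOn.isWeaklyHolomorphicOn`), and only this is used afterwards.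

Local completeness turns this into the existence of partial derivatives in `E`. Let `B` be the image
of a closed ball in `Ω` and `D` its bipolar, which is a closed disk by the Hahn-Banach theorem
(`isDisk_bipolar`). A functional bounded by `1` on `B` sees the difference quotients of a
holomorphic function bounded by `1` on a disc, and by the Schwarz lemma these are Lipschitz with a constant
independent of the functional (`norm_slope_sub_slope_le`). Hence the difference quotients of `f` are
Cauchy for the gauge of `D` and converge in `E_D`, so in `E`
(`IsWeaklyHolomorphicOn.exists_tendsto_diffQuot`). The Cauchy estimates show that the partial
derivatives are again weakly holomorphic and bounded on compact sets
(`IsWeaklyHolomorphicOn.cpartial`), so the argument can be iterated, and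
`e' (∂^β f) = ∂^β (e' ∘ f)`.

For complex-valued functions Cauchy's formula on a polydisc follows from the formula for derivatives
in one variable by induction on the dimension (`iterCPartial_eq_torusIntegral`). Read from right to
left it says that `(2πi)^d / β! • ∂^β f ζ`, already known to be an element of `E`, is the Pettis
integral of Cauchy's integrand.
-/

namespace LCHolo

/-! ### Holomorphic scalar functions on finite-dimensional spaces -/

/-- The Cauchy estimate for the differential, for a function bounded by `M` on a ball. -/
theorem norm_fderiv_le_of_norm_le_on_ball {V : Type*} [NormedAddCommGroup V] [NormedSpace ℂ V]
    {φ : V → ℂ} {z : V} {r M : ℝ} (hr : 0 < r) (hφ : DifferentiableOn ℂ φ (Metric.ball z r))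
    (hM : ∀ y ∈ Metric.ball z r, ‖φ y‖ ≤ M) : ‖fderiv ℂ φ z‖ ≤ 2 * M / r := by
  refine Complex.norm_fderiv_le_div_of_mapsTo_ball hφ (fun y hy => ?_) hr
  rw [mem_closedBall_iff_norm]
  linarith [norm_sub_le (φ y) (φ z), hM y hy, hM z (Metric.mem_ball_self hr)]

/-- The directional derivatives of a holomorphic function are holomorphic: near a given point they
are circle integrals of the function, which can be differentiated under the integral sign because
the Cauchy estimates bound the differential locally. -/
theorem differentiableOn_fderiv_apply {V : Type*} [NormedAddCommGroup V] [NormedSpace ℂ V]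
    [FiniteDimensional ℂ V] {φ : V → ℂ} {U : Set V} (hU : IsOpen U)
    (hφ : DifferentiableOn ℂ φ U) (v : V) :
    DifferentiableOn ℂ (fun z => fderiv ℂ φ z v) U := by
  intro z₀ hz₀
  refine DifferentiableAt.differentiableWithinAt ?_
  have : ProperSpace V := FiniteDimensional.proper ℂ V
  let : MeasurableSpace V := borel V
  have : BorelSpace V := ⟨rfl⟩
  have : ProperSpace (V →L[ℂ] ℂ) := FiniteDimensional.proper ℂ _
  obtain ⟨R, hR, hRU⟩ := Metric.nhds_basis_closedBall.mem_iff.1 (hU.mem_nhds hz₀)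
  obtain ⟨M, hM⟩ := (isCompact_closedBall z₀ R).exists_bound_of_continuousOn
    (hφ.continuousOn.mono hRU)
  set r := R / 4 with hr_def
  have hr : 0 < r := by positivity
  -- With this radius the circles `z + ξ • v`, `‖ξ‖ = ε`, stay in the ball of radius `2 * r`.
  set ε := r / (‖v‖ + 1) with hε_def
  have hε : 0 < ε := by positivity
  have hεv : ε * ‖v‖ < r := by
    rw [hε_def, div_mul_eq_mul_div, div_lt_iff₀ (by positivity)]
    nlinarith [norm_nonneg v]
  have hball : ∀ z ∈ Metric.ball z₀ r, ∀ ξ : ℂ, ‖ξ‖ ≤ ε → z + ξ • v ∈ Metric.ball z₀ (2 * r) := by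
    intro z hz ξ hξ
    rw [mem_ball_iff_norm] at hz ⊢
    calc ‖z + ξ • v - z₀‖ = ‖(z - z₀) + ξ • v‖ := by congr 1; abel
      _ ≤ ‖z - z₀‖ + ‖ξ‖ * ‖v‖ := (norm_add_le _ _).trans (by rw [norm_smul])
      _ < 2 * r := by nlinarith [norm_nonneg v, mul_le_mul_of_nonneg_right hξ (norm_nonneg v)]
  have hsub : Metric.ball z₀ (2 * r) ⊆ U := fun z hz => hRU <| by
    rw [Metric.mem_ball] at hz; rw [Metric.mem_closedBall]; linarith
  have hfd : ∀ y ∈ Metric.ball z₀ (2 * r), ‖fderiv ℂ φ y‖ ≤ 2 * M / (2 * r) := by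
    intro y hy
    have hy' : Metric.ball y (2 * r) ⊆ Metric.closedBall z₀ R := fun x hx => by
      rw [Metric.mem_ball] at hx hy
      rw [Metric.mem_closedBall]
      linarith [dist_triangle x y z₀]
    exact norm_fderiv_le_of_norm_le_on_ball (by positivity) (hφ.mono (hy'.trans hRU))
      fun x hx => hM x (hy' hx)
  have hξ : ∀ θ, ‖circleMap 0 ε θ‖ ≤ ε := fun θ => by simp [abs_of_pos hε]
  have hξ0 : ∀ θ, circleMap 0 ε θ ≠ 0 := fun θ => circleMap_ne_center hε.ne'
  set c : ℝ → ℂ := fun θ => deriv (circleMap 0 ε) θ * ((circleMap 0 ε θ - 0) ^ 2)⁻¹ with hc_def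
  have hc : Continuous c := by
    simp only [hc_def, deriv_circleMap, sub_zero]
    exact ((continuous_circleMap 0 ε).mul continuous_const).mul
      (((continuous_circleMap 0 ε).pow 2).inv₀ fun θ => pow_ne_zero 2 (hξ0 θ))
  have hslice : ∀ z ∈ Metric.ball z₀ r,
      fderiv ℂ φ z v = (2 * Real.pi * Complex.I : ℂ)⁻¹ •
        ∫ θ in (0 : ℝ)..2 * Real.pi, c θ * φ (z + circleMap 0 ε θ • v) := by
    intro z hz
    have hzU : z ∈ U := by simpa using hsub (hball z hz 0 (by simpa using hε.le))
    have hd : HasDerivAt (fun t : ℂ => φ (z + t • v)) (fderiv ℂ φ z v) 0 :=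
      ((hφ.differentiableAt (hU.mem_nhds hzU)).hasFDerivAt).hasLineDerivAt v
    rw [← hd.deriv]
    have := Complex.two_pi_I_inv_smul_circleIntegral_sub_sq_inv_smul_of_differentiable
      (U := {t : ℂ | z + t • v ∈ U}) (c := 0) (w₀ := 0) (R := ε)
      (f := fun t : ℂ => φ (z + t • v))
      (hU.preimage (by fun_prop)) (fun t ht => hsub (hball z hz t (by simpa using ht)))
      (fun t ht => ((hφ.differentiableAt (hU.mem_nhds ht)).comp t
        (by fun_prop : DifferentiableAt ℂ (fun t : ℂ => z + t • v) t)).differentiableWithinAt)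
      (Metric.mem_ball_self hε)
    rw [← this, circleIntegral]
    simp only [hc_def, smul_eq_mul, mul_assoc]
  have hcont : ∀ z ∈ Metric.ball z₀ r,
      Continuous (fun θ : ℝ => c θ * φ (z + circleMap 0 ε θ • v)) := by
    intro z hz
    refine hc.mul (hφ.continuousOn.comp_continuous (by fun_prop) fun θ => ?_)
    exact hsub (hball z hz _ (hξ θ))
  have key : HasFDerivAt
      (fun z => ∫ θ in (0 : ℝ)..2 * Real.pi, c θ * φ (z + circleMap 0 ε θ • v))
      (∫ θ in (0 : ℝ)..2 * Real.pi, c θ • fderiv ℂ φ (z₀ + circleMap 0 ε θ • v)) z₀ := by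
    refine intervalIntegral.hasFDerivAt_integral_of_dominated_of_fderiv_le
      (F' := fun z θ => c θ • fderiv ℂ φ (z + circleMap 0 ε θ • v))
      (bound := fun θ => ‖c θ‖ * (2 * M / (2 * r))) (Metric.ball_mem_nhds z₀ hr) ?_ ?_ ?_ ?_ ?_ ?_
    · filter_upwards [Metric.ball_mem_nhds z₀ hr] with z hz
      exact (hcont z hz).aestronglyMeasurable
    · exact (hcont z₀ (Metric.mem_ball_self hr)).intervalIntegrable _ _
    · refine hc.aestronglyMeasurable.smul (Measurable.aestronglyMeasurable ?_)
      exact (measurable_fderiv ℂ φ).comp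
        (by fun_prop : Continuous fun θ : ℝ => z₀ + circleMap 0 ε θ • v).measurable
    · refine Eventually.of_forall fun θ _ z hz => ?_
      rw [norm_smul]
      exact mul_le_mul_of_nonneg_left (hfd _ (hball z hz _ (hξ θ))) (norm_nonneg _)
    · exact (by fun_prop : Continuous fun θ => ‖c θ‖ * (2 * M / (2 * r))).intervalIntegrable _ _
    · refine Eventually.of_forall fun θ _ z hz => ?_
      have h1 := (hφ.differentiableAt
        (hU.mem_nhds (hsub (hball z hz _ (hξ θ))))).hasFDerivAt
      exact ((hasFDerivAt_comp_add_right _).2 h1).const_mul (c θ)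
  refine (key.differentiableAt.const_smul
    ((2 * Real.pi * Complex.I : ℂ)⁻¹)).congr_of_eventuallyEq ?_
  filter_upwards [Metric.ball_mem_nhds z₀ hr] with z hz using hslice z hz

/-- On half the radius, the difference quotient at `0` of a function bounded by `1` on a disc is
Lipschitz with a constant depending only on the radius: it is holomorphic and bounded by the
Schwarz lemma, which then applies to the difference quotient itself. -/
theorem norm_slope_sub_slope_le {φ : ℂ → ℂ} {r : ℝ} (hr : 0 < r)
    (hφ : DifferentiableOn ℂ φ (Metric.ball 0 r)) (h1 : ∀ t ∈ Metric.ball (0 : ℂ) r, ‖φ t‖ ≤ 1)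
    {s t : ℂ} (hs : s ≠ 0) (ht : t ≠ 0) (hs' : ‖s‖ < r / 4) (ht' : ‖t‖ < r / 4) :
    ‖s⁻¹ * (φ s - φ 0) - t⁻¹ * (φ t - φ 0)‖ ≤ 8 / r ^ 2 * ‖s - t‖ := by
  have hd : DifferentiableOn ℂ (dslope φ 0) (Metric.ball 0 r) :=
    (Complex.differentiableOn_dslope (Metric.ball_mem_nhds 0 hr)).2 hφ
  have hb : ∀ y ∈ Metric.ball (0 : ℂ) r, ‖dslope φ 0 y‖ ≤ 2 / r := by
    intro y hy
    refine Complex.norm_dslope_le_div_of_mapsTo_ball hφ (fun x hx => ?_) hy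
    rw [mem_closedBall_iff_norm]
    linarith [norm_sub_le (φ x) (φ 0), h1 x hx, h1 0 (Metric.mem_ball_self hr)]
  have hsub : Metric.ball t (r / 2) ⊆ Metric.ball 0 r := fun y hy => by
    rw [mem_ball_iff_norm] at hy ⊢
    have : ‖y - 0‖ ≤ ‖y - t‖ + ‖t‖ := by
      rw [sub_zero]; simpa using norm_add_le (y - t) t
    linarith
  have hst : s ∈ Metric.ball t (r / 2) := by
    rw [mem_ball_iff_norm]; linarith [norm_sub_le s t]
  have := Complex.dist_le_div_mul_dist_of_mapsTo_ball (R₂ := 4 / r) (hd.mono hsub)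
    (fun y hy => by
      rw [mem_closedBall_iff_norm]
      have h2 := hb y (hsub hy)
      have h3 := hb t (hsub (Metric.mem_ball_self (by positivity)))
      have h4 : 4 / r = 2 / r + 2 / r := by ring
      linarith [norm_sub_le (dslope φ 0 y) (dslope φ 0 t)]) hst
  rw [dslope_of_ne _ hs, dslope_of_ne _ ht, slope_def_module, slope_def_module, dist_eq_norm,
    dist_eq_norm, sub_zero, sub_zero, smul_eq_mul, smul_eq_mul] at this
  refine this.trans_eq ?_
  ring

/-- **Cauchy's integral formula** for the derivatives of all orders, at any point of the disc. -/
theorem iteratedDeriv_eq_circleIntegral {U : Set ℂ} (hU : IsOpen U) {c ζ : ℂ} {R : ℝ}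
    (hcU : Metric.closedBall c R ⊆ U) (hζ : ζ ∈ Metric.ball c R) (n : ℕ) :
    ∀ g : ℂ → ℂ, DifferentiableOn ℂ g U →
    iteratedDeriv n g ζ = (n.factorial / (2 * Real.pi * Complex.I) : ℂ) *
      ∮ z in C(c, R), ((z - ζ) ^ (n + 1))⁻¹ * g z := by
  have hR : 0 < R := Metric.pos_of_mem_ball hζ
  induction n with
  | zero =>
    intro g hg
    have := (hg.mono hcU).circleIntegral_sub_inv_smul hζ
    simp only [smul_eq_mul] at this
    simp only [zero_add, pow_one, this, iteratedDeriv_zero, Nat.factorial_zero, Nat.cast_one]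
    field_simp
  | succ n ih =>
    intro g hg
    rw [iteratedDeriv_succ', ih _ (hg.deriv hU)]
    have hne : ∀ z ∈ Metric.sphere c R, z - ζ ≠ 0 := fun z hz h => by
      rw [sub_eq_zero] at h
      rw [h, Metric.mem_sphere] at hz
      exact (Metric.mem_ball.1 hζ).ne hz
    have hsU : Metric.sphere c R ⊆ U := Metric.sphere_subset_closedBall.trans hcU
    have hi : ∀ m : ℕ, ∀ k : ℂ → ℂ, ContinuousOn k (Metric.sphere c R) →
        CircleIntegrable (fun z => ((z - ζ) ^ m)⁻¹ * k z) c R := fun m k hk =>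
      ContinuousOn.circleIntegrable hR.le
        ((ContinuousOn.inv₀ (by fun_prop) fun z hz => pow_ne_zero m (hne z hz)).mul hk)
    have hi1 := hi (n + 1) _ ((hg.deriv hU).continuousOn.mono hsU)
    have hi2 := hi (n + 1 + 1) _ (hg.continuousOn.mono hsU)
    -- Integration by parts: the derivative of `g z / (z - ζ) ^ (n + 1)` has integral zero.
    have h0 : (∮ z in C(c, R), (((z - ζ) ^ (n + 1))⁻¹ * deriv g z -
        ((n : ℂ) + 1) * (((z - ζ) ^ (n + 1 + 1))⁻¹ * g z))) = 0 := by
      refine circleIntegral.integral_eq_zero_of_hasDerivWithinAt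
        (f := fun z => ((z - ζ) ^ (n + 1))⁻¹ * g z) hR.le fun z hz => ?_
      have h1 := (((hasDerivAt_id z).sub_const ζ).pow (n + 1)).inv (pow_ne_zero _ (hne z hz))
      have h2 := (hg.differentiableAt (hU.mem_nhds (hsU hz))).hasDerivAt
      refine ((h1.mul h2).congr_deriv ?_).hasDerivWithinAt
      have := hne z hz
      simp only [id]
      push_cast
      field_simp
      simp only [Pi.pow_apply, Pi.inv_apply]
      field_simp
      ring
    have hi3 : CircleIntegrable (fun z => ((n : ℂ) + 1) * (((z - ζ) ^ (n + 1 + 1))⁻¹ * g z)) c R :=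
      hi2.const_fun_smul (a := (n : ℂ) + 1)
    rw [circleIntegral.integral_sub hi1 hi3, sub_eq_zero,
      circleIntegral.integral_const_mul] at h0
    rw [h0, Nat.factorial_succ]
    push_cast
    ring

/-! ### Bipolars of bounded sets -/

section Bipolar

variable {E : Type*} [AddCommGroup E] [Module ℂ E] [TopologicalSpace E]

/-- The bipolar of `B`: the points at which every continuous linear functional bounded by `1` on
`B` is bounded by `1`. -/
def bipolar (B : Set E) : Set E :=
  {x | ∀ e' : E →L[ℂ] ℂ, (∀ b ∈ B, ‖e' b‖ ≤ 1) → ‖e' x‖ ≤ 1}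

theorem isClosed_bipolar (B : Set E) : IsClosed (bipolar B) := by
  simp only [bipolar, ofPred_forall]
  exact isClosed_iInter fun e' => isClosed_iInter fun _ =>
    isClosed_le e'.continuous.norm continuous_const

theorem balanced_bipolar (B : Set E) : Balanced ℂ (bipolar B) := by
  rintro a ha _ ⟨x, hx, rfl⟩ e' he'
  simp only [map_smul, norm_smul]
  exact mul_le_one₀ ha (norm_nonneg _) (hx e' he')

theorem convex_bipolar (B : Set E) : Convex ℝ (bipolar B) := by
  intro x hx y hy a b ha hb hab e' he'
  rw [map_add, ← Complex.coe_smul, ← Complex.coe_smul, map_smul, map_smul]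
  refine (norm_add_le _ _).trans ?_
  simp only [norm_smul, Complex.norm_real, Real.norm_of_nonneg ha, Real.norm_of_nonneg hb]
  nlinarith [hx e' he', hy e' he']

/-- The part of the bipolar theorem needed here: by the Hahn-Banach theorem, bipolars of bounded
sets are bounded. -/
theorem isVonNBounded_bipolar [IsTopologicalAddGroup E] [ContinuousSMul ℂ E]
    [LocallyConvexSpace ℝ E] {B : Set E} (hB : Bornology.IsVonNBounded ℂ B) :
    Bornology.IsVonNBounded ℂ (bipolar B) := by
  have : ContinuousSMul ℝ E := IsScalarTower.continuousSMul ℂ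
  refine (LocallyConvexSpace.convex_open_basis_zero ℝ E).isVonNBounded_iff.2 fun V hV => ?_
  obtain ⟨h0, hVo, hVc⟩ := hV
  obtain ⟨r, hr, h⟩ := (hB (hVo.mem_nhds h0)).exists_pos
  refine Absorbs.of_norm ⟨2 * r, fun c hc x hx => ?_⟩
  have hc0 : c ≠ 0 := norm_pos_iff.1 (by linarith)
  rw [id, mem_smul_set_iff_inv_smul_mem₀ hc0]
  by_contra hxV
  obtain ⟨f, hf, hfV⟩ := RCLike.separate_convex_open_set (𝕜 := ℂ) h0 hVc hVo hxV
  -- The factor `2` turns the non-strict bound on the bipolar into a contradiction.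
  have hpolar : ∀ b ∈ B, ‖((2 * c⁻¹) • f) b‖ ≤ 1 := by
    intro b hb
    set y := ((2 * c⁻¹) • f) b with hy
    by_cases hy0 : y = 0
    · simp [hy0]
    -- Rotating `b` makes the value of the functional real and nonnegative.
    set a : ℂ := (starRingEnd ℂ) y / ‖y‖ with ha
    have hny : (‖y‖ : ℂ) ≠ 0 := by simpa using hy0
    have ha1 : ‖a‖ = 1 := by
      rw [ha, norm_div, RCLike.norm_conj, Complex.norm_real, norm_norm,
        div_self (norm_ne_zero_iff.2 hy0)]
    have ha0 : a ≠ 0 := norm_ne_zero_iff.1 (by rw [ha1]; exact one_ne_zero)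
    have hay : a * y = ‖y‖ := by
      rw [ha, div_mul_eq_mul_div, Complex.conj_mul', sq, mul_div_assoc, div_self hny, mul_one]
    have hbV : (a * (2 * c⁻¹)) • b ∈ V := by
      have := h (a * (2 * c⁻¹))⁻¹ (by
        rw [norm_inv, norm_mul, norm_mul, ha1, norm_inv, Complex.norm_two]
        field_simp
        linarith) hb
      rwa [mem_smul_set_iff_inv_smul_mem₀ (by simp [ha0, hc0]), inv_inv] at this
    have := hfV _ hbV
    rw [map_smul, smul_eq_mul, mul_assoc, ← smul_eq_mul (a := 2 * c⁻¹),
      ← smul_apply, ← hy, hay] at this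
    simpa using this.le
  have h1 := hx _ hpolar
  rw [smul_apply, mul_smul, ← map_smul, norm_smul, Complex.norm_two] at h1
  have h2 := Complex.re_le_norm (f (c⁻¹ • x))
  have h3 : (f (c⁻¹ • x)).re = 1 := hf
  linarith

theorem isDisk_bipolar [IsTopologicalAddGroup E] [ContinuousSMul ℂ E]
    [LocallyConvexSpace ℝ E] {B : Set E} (hB : Bornology.IsVonNBounded ℂ B) :
    IsDisk (bipolar B) :=
  ⟨isVonNBounded_bipolar hB, balanced_bipolar B, convex_bipolar B⟩

end Bipolar

/-! ### Weakly holomorphic functions -/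

section Weak

variable {d : ℕ} {E : Type*} [AddCommGroup E] [Module ℂ E]

/-- `f` is weakly holomorphic on `Ω` and bounded on the compact subsets of `Ω`. -/
structure IsWeaklyHolomorphicOn [TopologicalSpace E] (f : Cd d → E) (Ω : Set (Cd d)) : Prop where
  differentiableOn : ∀ e' : E →L[ℂ] ℂ, DifferentiableOn ℂ (fun z => e' (f z)) Ω
  isVonNBounded : ∀ K ⊆ Ω, IsCompact K → Bornology.IsVonNBounded ℂ (f '' K)

/-- The completion of a complex topological vector space is a topological vector space: the
closures of the balanced neighbourhoods of `0` form a basis of balanced neighbourhoods of `0`. -/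
theorem continuousSMul_completion (E : Type*) [AddCommGroup E] [Module ℂ E] [UniformSpace E]
    [IsUniformAddGroup E] [ContinuousSMul ℂ E] :
    ContinuousSMul ℂ (UniformSpace.Completion E) := by
  have hbasis : ∀ W ∈ 𝓝 (0 : UniformSpace.Completion E), ∃ N ∈ 𝓝 (0 : UniformSpace.Completion E),
      ∃ V ∈ 𝓝 (0 : E), N ⊆ W ∧ (∀ x ∈ V, (x : UniformSpace.Completion E) ∈ N) ∧
      ∀ a : ℂ, ‖a‖ ≤ 1 → ∀ y ∈ N, a • y ∈ N := by
    intro W hW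
    have hb := (nhds_basis_balanced ℂ E).hasBasis_of_isDenseInducing
      (UniformSpace.Completion.isDenseInducing_coe (α := E))
    rw [UniformSpace.Completion.coe_zero] at hb
    obtain ⟨V, ⟨hV, hVb⟩, hVW⟩ := hb.mem_iff.1 hW
    refine ⟨_, hb.mem_of_mem ⟨hV, hVb⟩, V, hV, hVW,
      fun x hx => subset_closure (mem_image_of_mem _ hx), fun a ha y hy => ?_⟩
    refine map_mem_closure (continuous_const_smul a) hy ?_
    rintro _ ⟨x, hx, rfl⟩
    exact ⟨a • x, hVb a ha (smul_mem_smul_set hx), UniformSpace.Completion.coe_smul a x⟩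
  have hball : ∀ᶠ a : ℂ in 𝓝 0, ‖a‖ ≤ 1 := by
    filter_upwards [Metric.closedBall_mem_nhds (0 : ℂ) one_pos] with a ha using by simpa using ha
  refine ContinuousSMul.of_nhds_zero ?_ ?_ ?_
  · intro W hW
    obtain ⟨N, hN, -, -, hNW, -, hNb⟩ := hbasis W hW
    exact (hball.prod_mk hN).mono fun p hp => hNW (hNb p.1 hp.1 p.2 hp.2)
  · intro m W hW
    obtain ⟨W', hW', hWW⟩ := exists_nhds_zero_half hW
    obtain ⟨N, hN, V, hV, hNW, hVN, hNb⟩ := hbasis W' hW'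
    -- `m` is the sum of a small vector and of a vector of `E`.
    have : ∀ᶠ y in 𝓝 m, m - y ∈ N := by
      have : Tendsto (fun y => m - y) (𝓝 m) (𝓝 0) :=
        (by fun_prop : Continuous fun y => m - y).tendsto' _ _ (sub_self m)
      exact this hN
    obtain ⟨e, he⟩ := (UniformSpace.Completion.denseRange_coe (α := E)).exists_mem_open
      isOpen_interior ⟨m, mem_interior_iff_mem_nhds.2 this⟩
    have he' : m - (e : UniformSpace.Completion E) ∈ N :=
      interior_subset (s := {y | m - y ∈ N}) he
    have hsm : Tendsto (fun a : ℂ => a • e) (𝓝 0) (𝓝 0) :=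
      (by fun_prop : Continuous fun a : ℂ => a • e).tendsto' _ _ (zero_smul ℂ e)
    have hsV : ∀ᶠ a : ℂ in 𝓝 0, a • e ∈ V := hsm hV
    rw [mem_map]
    filter_upwards [hball, hsV] with a ha hae
    have h := hWW _ (hNW (hNb a ha _ he')) _ (hNW (hVN _ hae))
    rwa [UniformSpace.Completion.coe_smul, smul_sub, sub_add_cancel] at h
  · exact fun a => (continuous_const_smul a).tendsto' _ _ (smul_zero a)

section Holomorphic

variable [UniformSpace E] [IsUniformAddGroup E] [ContinuousSMul ℂ E] {f : Cd d → E}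
  {Ω : Set (Cd d)}

theorem IsHolomorphicOn.differentiableOn (hf : IsHolomorphicOn f Ω) (e' : E →L[ℂ] ℂ) :
    DifferentiableOn ℂ (fun z => e' (f z)) Ω := by
  obtain ⟨df, hdf, -⟩ := hf
  intro z hz
  set L : Cd d →ₗ[ℂ] ℂ := (e'.fromCompletion : UniformSpace.Completion E →ₗ[ℂ] ℂ) ∘ₗ df z
  have h := ((e'.fromCompletion.continuous.tendsto 0).comp (hdf z hz)).norm
  rw [map_zero, norm_zero] at h
  refine (HasFDerivWithinAt.differentiableWithinAt (f' := LinearMap.toContinuousLinearMap L) ?_)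
  rw [← hasFDerivWithinAt_sdiff_singleton_self, hasFDerivWithinAt_iff_tendsto]
  refine h.congr fun y => ?_
  simp only [Function.comp_apply, map_smul, map_sub, ContinuousLinearMap.fromCompletion_apply_coe,
    norm_smul, norm_inv, Complex.norm_real, norm_norm]
  rfl

/-- Convergence in the completion of points of `E` to a point of `E` is convergence in `E`, whose
topology is induced. -/
theorem IsHolomorphicOn.continuousOn (hf : IsHolomorphicOn f Ω) : ContinuousOn f Ω := by
  have := continuousSMul_completion E
  obtain ⟨df, hdf, -⟩ := hf
  intro z hz
  refine continuousWithinAt_sdiff_self.1 ?_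
  rw [ContinuousWithinAt,
    (UniformSpace.Completion.isDenseInducing_coe (α := E)).isInducing.tendsto_nhds_iff]
  have h1 : Tendsto (fun y : Cd d => (‖y - z‖ : ℂ)) (𝓝[Ω \ {z}] z) (𝓝 0) :=
    ((by fun_prop : Continuous fun y : Cd d => (‖y - z‖ : ℂ)).tendsto' z 0 (by simp)).mono_left
      nhdsWithin_le_nhds
  have h2 : Tendsto (fun y : Cd d => df z (y - z)) (𝓝[Ω \ {z}] z) (𝓝 0) :=
    (((df z).continuous_of_finiteDimensional.comp (continuous_id.sub continuous_const)).tendsto'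
      z 0 (by simp)).mono_left nhdsWithin_le_nhds
  have h3 := ((h1.smul (hdf z hz)).add h2).add_const (f z : UniformSpace.Completion E)
  rw [zero_smul, zero_add, zero_add] at h3
  refine h3.congr' ?_
  filter_upwards [self_mem_nhdsWithin] with y hy
  have hne : (‖y - z‖ : ℂ) ≠ 0 := by simpa [sub_eq_zero] using hy.2
  rw [smul_inv_smul₀ hne, sub_add_cancel, sub_add_cancel, Function.comp_apply]

theorem IsHolomorphicOn.isWeaklyHolomorphicOn (hf : IsHolomorphicOn f Ω) :
    IsWeaklyHolomorphicOn f Ω :=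
  ⟨hf.differentiableOn, fun _ hK hKc => (hKc.image_of_continuousOn
    (hf.continuousOn.mono hK)).isVonNBounded ℂ⟩

end Holomorphic

end Weak

/-! ### Partial derivatives of weakly holomorphic functions -/

section Gauge

variable {E : Type*} [AddCommGroup E] [Module ℂ E] [TopologicalSpace E]

theorem mem_smul_bipolar_iff {B : Set E} {C : ℝ} (hC : 0 < C) {x : E} :
    x ∈ C • bipolar B ↔ ∀ e' : E →L[ℂ] ℂ, (∀ b ∈ B, ‖e' b‖ ≤ 1) → ‖e' x‖ ≤ C := by
  rw [mem_smul_set_iff_inv_smul_mem₀ hC.ne']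
  refine forall_congr' fun e' => imp_congr_right fun _ => ?_
  rw [← Complex.coe_smul, map_smul, norm_smul, Complex.norm_real, norm_inv,
    Real.norm_of_nonneg hC.le, inv_mul_le_iff₀ hC, mul_one]

theorem gauge_bipolar_le {B : Set E} {C : ℝ} (hC : 0 ≤ C) {x : E}
    (h : ∀ e' : E →L[ℂ] ℂ, (∀ b ∈ B, ‖e' b‖ ≤ 1) → ‖e' x‖ ≤ C) : gauge (bipolar B) x ≤ C :=
  le_of_forall_gt_imp_ge_of_dense fun _ hC' => gauge_le_of_mem (hC.trans hC'.le)
    ((mem_smul_bipolar_iff (hC.trans_lt hC')).2 fun e' he' => (h e' he').trans hC'.le)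

/-- The membership hypothesis excludes points outside `E_D`, where the gauge has the junk value
`0`. -/
theorem norm_apply_le_gauge_bipolar {B : Set E} {C : ℝ} (hC : 0 < C) {x : E}
    (hx : x ∈ C • bipolar B) (e' : E →L[ℂ] ℂ) (he' : ∀ b ∈ B, ‖e' b‖ ≤ 1) :
    ‖e' x‖ ≤ gauge (bipolar B) x :=
  le_csInf ⟨C, hC, hx⟩ fun _ hs => (mem_smul_bipolar_iff hs.1).1 hs.2 e' he'

/-- The multiples `n • D` in the definition of `E_D` may be replaced by arbitrary positive real
multiples. -/
theorem mem_diskSpan_bipolar_iff {B : Set E} {x : E} :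
    x ∈ diskSpan (bipolar B) ↔ ∃ C : ℝ, 0 < C ∧ x ∈ C • bipolar B := by
  constructor
  · rintro hx
    obtain ⟨n, hn⟩ := mem_iUnion.1 hx
    refine ⟨n + 1, by positivity, (mem_smul_bipolar_iff (by positivity)).2 fun e' he' => ?_⟩
    obtain ⟨y, hy, rfl⟩ := hn
    have := hy e' he'
    simp only [← Complex.coe_smul, map_smul, norm_smul, Complex.norm_real, Real.norm_natCast]
    nlinarith [(n.cast_nonneg : (0 : ℝ) ≤ n)]
  · rintro ⟨C, hC, hx⟩
    obtain ⟨n, hn⟩ := exists_nat_gt C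
    refine mem_iUnion.2 ⟨n, (mem_smul_bipolar_iff (hC.trans hn)).2 fun e' he' => ?_⟩
    exact ((mem_smul_bipolar_iff hC).1 hx e' he').trans hn.le

end Gauge

section Partial

variable {d : ℕ} {E : Type*} [AddCommGroup E] [Module ℂ E] [TopologicalSpace E]
  {f : Cd d → E} {Ω : Set (Cd d)}

theorem add_smul_single_mem_closedBall {z : Cd d} {r : ℝ} (j : Fin d) {t : ℂ} (ht : ‖t‖ ≤ r) :
    z + t • EuclideanSpace.single j (1 : ℂ) ∈ Metric.closedBall z r := by
  simpa [norm_smul] using ht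

/-- A functional bounded by `1` on the image of a ball sees the difference quotients of a function
bounded by `1` on a disc. -/
theorem norm_apply_diffQuot_sub_le {e' : E →L[ℂ] ℂ}
    (hf : DifferentiableOn ℂ (fun z => e' (f z)) Ω) (j : Fin d) {z : Cd d} {r : ℝ} (hr : 0 < r)
    (hrΩ : Metric.closedBall z r ⊆ Ω) (he' : ∀ b ∈ f '' Metric.closedBall z r, ‖e' b‖ ≤ 1)
    {s t : ℂ} (hs : s ≠ 0) (ht : t ≠ 0) (hs' : ‖s‖ < r / 4) (ht' : ‖t‖ < r / 4) :
    ‖e' (diffQuot f j z s - diffQuot f j z t)‖ ≤ 8 / r ^ 2 * ‖s - t‖ := by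
  obtain ⟨v, hv⟩ : ∃ v : Cd d, v = EuclideanSpace.single j (1 : ℂ) := ⟨_, rfl⟩
  have hmem : ∀ t ∈ Metric.ball (0 : ℂ) r, z + t • v ∈ Metric.closedBall z r := fun t ht =>
    hv ▸ add_smul_single_mem_closedBall j (mem_ball_zero_iff.1 ht).le
  have hline : Differentiable ℂ fun t : ℂ => z + t • v :=
    (differentiable_id.smul_const v).const_add z
  have hd : DifferentiableOn ℂ (fun t : ℂ => e' (f (z + t • v))) (Metric.ball 0 r) :=
    DifferentiableOn.comp (g := fun z => e' (f z)) (t := Ω) hf hline.differentiableOn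
      fun t ht => hrΩ (hmem t ht)
  have := norm_slope_sub_slope_le hr hd
    (fun t ht => he' _ (mem_image_of_mem f (hmem t ht))) hs ht hs' ht'
  simpa only [diffQuot, ← hv, map_sub, map_smul, smul_eq_mul, zero_smul, add_zero] using this

/-- The difference quotients of `f` form a Cauchy net for the gauge of the bipolar of the image of a
ball. Local completeness provides a limit for the gauge, hence a limit in `E`. -/
theorem IsWeaklyHolomorphicOn.exists_tendsto_diffQuot [IsTopologicalAddGroup E]
    [ContinuousSMul ℂ E] [LocallyConvexSpace ℝ E] (hE : IsLocallyComplete E) (hΩ : IsOpen Ω)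
    (hf : IsWeaklyHolomorphicOn f Ω) (j : Fin d) {z : Cd d} (hz : z ∈ Ω) :
    ∃ e : E, Tendsto (diffQuot f j z) (𝓝[≠] (0 : ℂ)) (𝓝 e) := by
  obtain ⟨r, hr, hrΩ⟩ := Metric.nhds_basis_closedBall.mem_iff.1 (hΩ.mem_nhds hz)
  set B := f '' Metric.closedBall z r with hB_def
  have hD := isDisk_bipolar (hf.isVonNBounded _ hrΩ (isCompact_closedBall z r))
  set κ := 8 / r ^ 2 with hκ_def
  have hκ : 0 < κ := by positivity
  have hq : ∀ e' : E →L[ℂ] ℂ, (∀ b ∈ B, ‖e' b‖ ≤ 1) → ∀ s t : ℂ, s ≠ 0 → t ≠ 0 →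
      ‖s‖ < r / 4 → ‖t‖ < r / 4 → ‖e' (diffQuot f j z s - diffQuot f j z t)‖ ≤ κ * ‖s - t‖ :=
    fun e' he' s t hs ht hs' ht' =>
      norm_apply_diffQuot_sub_le (hf.differentiableOn e') j hr hrΩ he' hs ht hs' ht'
  -- Local completeness is stated for sequences, so fix one of admissible increments tending to `0`.
  set h : ℕ → ℂ := fun n => ((r / 8 * (1 / ((n : ℝ) + 1)) : ℝ) : ℂ) with hh_def
  have hh0 : Tendsto h atTop (𝓝 0) := by
    have := (tendsto_one_div_add_atTop_nhds_zero_nat (𝕜 := ℝ)).const_mul (r / 8)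
    rw [mul_zero] at this
    exact (Complex.continuous_ofReal.tendsto' 0 0 Complex.ofReal_zero).comp this
  have hhne : ∀ n, h n ≠ 0 := fun n => by
    simp only [hh_def, ne_eq, Complex.ofReal_eq_zero]
    positivity
  have hhr : ∀ n, ‖h n‖ < r / 4 := fun n => by
    have h1 : 1 / ((n : ℝ) + 1) ≤ 1 := by
      rw [div_le_one (by positivity)]; linarith [(n.cast_nonneg : (0 : ℝ) ≤ n)]
    rw [hh_def, Complex.norm_real, Real.norm_of_nonneg (by positivity)]
    nlinarith
  set u : ℕ → E := fun n => diffQuot f j z (h n) with hu_def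
  have hu : ∀ n, u n ∈ diskSpan (bipolar B) := by
    intro n
    have hn : 0 < ‖h n‖ := norm_pos_iff.2 (hhne n)
    refine mem_diskSpan_bipolar_iff.2 ⟨‖h n‖⁻¹ * 2, by positivity,
      (mem_smul_bipolar_iff (by positivity)).2 fun e' he' => ?_⟩
    change ‖e' ((h n)⁻¹ • (f (z + h n • EuclideanSpace.single j (1 : ℂ)) - f z))‖ ≤ _
    rw [map_smul, norm_smul, norm_inv, map_sub]
    have h1 := he' _ (mem_image_of_mem f (add_smul_single_mem_closedBall (z := z) (r := r) j
      (t := h n) (by linarith [hhr n])))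
    have h2 := he' _ (mem_image_of_mem f (Metric.mem_closedBall_self (x := z) hr.le))
    refine mul_le_mul_of_nonneg_left ?_ (by positivity)
    linarith [norm_sub_le (e' (f (z + h n • EuclideanSpace.single j (1 : ℂ)))) (e' (f z))]
  obtain ⟨x, hx, hux⟩ := hE _ hD (isClosed_bipolar B) u hu (by
    intro ε hε
    obtain ⟨N, hN⟩ := Metric.tendsto_atTop.1 hh0 (ε / (2 * κ)) (by positivity)
    refine ⟨N, fun m hm n hn => ?_⟩
    refine (gauge_bipolar_le (C := κ * ‖h m - h n‖) (by positivity) fun e' he' =>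
      hq e' he' _ _ (hhne m) (hhne n) (hhr m) (hhr n)).trans_lt ?_
    have h1 := hN m hm
    have h2 := hN n hn
    rw [dist_zero_right] at h1 h2
    calc κ * ‖h m - h n‖ < κ * (ε / (2 * κ) + ε / (2 * κ)) :=
          mul_lt_mul_of_pos_left ((norm_sub_le _ _).trans_lt (add_lt_add h1 h2)) hκ
      _ = ε := by field_simp; ring)
  refine ⟨x, ?_⟩
  have hlim : ∀ t : ℂ, t ≠ 0 → ‖t‖ < r / 4 → ∀ e' : E →L[ℂ] ℂ, (∀ b ∈ B, ‖e' b‖ ≤ 1) →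
      ‖e' (diffQuot f j z t - x)‖ ≤ κ * ‖t‖ := by
    intro t ht ht' e' he'
    have hlim' : Tendsto (fun n => κ * ‖t - h n‖ + gauge (bipolar B) (u n - x)) atTop
        (𝓝 (κ * ‖t‖)) := by
      simpa using (((tendsto_const_nhds (x := t)).sub hh0).norm.const_mul κ).add hux
    refine ge_of_tendsto' hlim' fun n => ?_
    obtain ⟨C₁, hC₁, h₁⟩ := mem_diskSpan_bipolar_iff.1 (hu n)
    obtain ⟨C₂, hC₂, h₂⟩ := mem_diskSpan_bipolar_iff.1 hx
    have hsub : u n - x ∈ (C₁ + C₂) • bipolar B :=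
      (mem_smul_bipolar_iff (by positivity)).2 fun e' he' => by
        rw [map_sub]
        exact (norm_sub_le _ _).trans (add_le_add ((mem_smul_bipolar_iff hC₁).1 h₁ e' he')
          ((mem_smul_bipolar_iff hC₂).1 h₂ e' he'))
    have h3 := norm_apply_le_gauge_bipolar (by positivity) hsub e' he'
    have h4 := hq e' he' t (h n) ht (hhne n) ht' (hhr n)
    calc ‖e' (diffQuot f j z t - x)‖ = ‖e' (diffQuot f j z t - u n) + e' (u n - x)‖ := by
          rw [← map_add, sub_add_sub_cancel]
      _ ≤ _ := (norm_add_le _ _).trans (add_le_add h4 h3)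
  have hκt : Tendsto (fun t : ℂ => ((κ * ‖t‖ : ℝ) : ℂ)) (𝓝[≠] 0) (𝓝 0) :=
    ((by fun_prop : Continuous fun t : ℂ => ((κ * ‖t‖ : ℝ) : ℂ)).tendsto' 0 0 (by simp)).mono_left
      nhdsWithin_le_nhds
  have hev : ∀ᶠ t : ℂ in 𝓝[≠] 0, t ≠ 0 ∧ ‖t‖ < r / 4 := by
    refine (eventually_mem_nhdsWithin.mono fun t ht => ht).and
      (eventually_nhdsWithin_of_eventually_nhds ?_)
    filter_upwards [Metric.ball_mem_nhds (0 : ℂ) (by positivity : 0 < r / 4)] with t ht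
    simpa using ht
  -- `D` is bounded, so a net in `κ * ‖t‖ • D` tends to `0` with `t`.
  have hzero := hD.1.smul_tendsto_zero (ε := fun t : ℂ => ((κ * ‖t‖ : ℝ) : ℂ))
    (x := fun t => (((κ * ‖t‖ : ℝ) : ℂ))⁻¹ • (diffQuot f j z t - x)) (l := 𝓝[≠] 0)
    (hev.mono fun t ht => by
      have hpos : 0 < κ * ‖t‖ := mul_pos hκ (norm_pos_iff.2 ht.1)
      have := (mem_smul_bipolar_iff hpos).2 (hlim t ht.1 ht.2)
      rwa [mem_smul_set_iff_inv_smul_mem₀ hpos.ne', ← Complex.coe_smul, Complex.ofReal_inv] at this)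
    hκt
  have := hzero.add_const x
  rw [zero_add] at this
  refine this.congr' ?_
  filter_upwards [hev] with t ht
  have hne : ((κ * ‖t‖ : ℝ) : ℂ) ≠ 0 :=
    Complex.ofReal_ne_zero.2 (mul_pos hκ (norm_pos_iff.2 ht.1)).ne'
  simp only [Pi.smul_apply']
  rw [smul_inv_smul₀ hne, sub_add_cancel]

theorem tendsto_diffQuot_cpartial {j : Fin d} {z : Cd d}
    (h : ∃ e : E, Tendsto (diffQuot f j z) (𝓝[≠] (0 : ℂ)) (𝓝 e)) :
    Tendsto (diffQuot f j z) (𝓝[≠] (0 : ℂ)) (𝓝 (cpartial j f z)) :=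
  tendsto_nhds_limUnder h

theorem tendsto_diffQuot_fderiv {φ : Cd d → ℂ} {z : Cd d} (hφ : DifferentiableAt ℂ φ z)
    (j : Fin d) :
    Tendsto (diffQuot φ j z) (𝓝[≠] (0 : ℂ)) (𝓝 (fderiv ℂ φ z (EuclideanSpace.single j 1))) :=
  hasLineDerivAt_iff_tendsto_slope_zero.1 (hφ.hasFDerivAt.hasLineDerivAt _)

theorem cpartial_eq_fderiv {φ : Cd d → ℂ} {z : Cd d} (hφ : DifferentiableAt ℂ φ z) (j : Fin d) :
    cpartial j φ z = fderiv ℂ φ z (EuclideanSpace.single j 1) :=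
  (tendsto_diffQuot_fderiv hφ j).limUnder_eq

theorem differentiableOn_cpartial (hΩ : IsOpen Ω) {φ : Cd d → ℂ} (hφ : DifferentiableOn ℂ φ Ω)
    (j : Fin d) : DifferentiableOn ℂ (cpartial j φ) Ω :=
  (differentiableOn_fderiv_apply hΩ hφ (EuclideanSpace.single j 1)).congr fun _ hz =>
    cpartial_eq_fderiv (hφ.differentiableAt (hΩ.mem_nhds hz)) j

theorem apply_cpartial {j : Fin d} {z : Cd d}
    (h : ∃ e : E, Tendsto (diffQuot f j z) (𝓝[≠] (0 : ℂ)) (𝓝 e)) (e' : E →L[ℂ] ℂ)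
    (hd : DifferentiableAt ℂ (fun z => e' (f z)) z) :
    e' (cpartial j f z) = cpartial j (fun z => e' (f z)) z := by
  rw [cpartial_eq_fderiv hd]
  refine tendsto_nhds_unique ((e'.continuous.tendsto _).comp (tendsto_diffQuot_cpartial h))
    ((tendsto_diffQuot_fderiv hd j).congr fun t => ?_)
  simp [diffQuot]

theorem cpartial_congr (hΩ : IsOpen Ω) {g : Cd d → E} (h : EqOn f g Ω) (j : Fin d) :
    EqOn (cpartial j f) (cpartial j g) Ω := by
  intro z hz
  have hev : diffQuot f j z =ᶠ[𝓝[≠] 0] diffQuot g j z := by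
    have hc : Tendsto (fun t : ℂ => z + t • EuclideanSpace.single j (1 : ℂ)) (𝓝 0) (𝓝 z) :=
      (by fun_prop : Continuous fun t : ℂ =>
        z + t • EuclideanSpace.single j (1 : ℂ)).tendsto' _ _ (by simp)
    filter_upwards [nhdsWithin_le_nhds (hc (hΩ.mem_nhds hz))] with t ht
    rw [diffQuot, diffQuot, h ht, h hz]
  simp only [cpartial, limUnder, Filter.map_congr hev]

theorem IsWeaklyHolomorphicOn.cpartial [IsTopologicalAddGroup E]
    [ContinuousSMul ℂ E] [LocallyConvexSpace ℝ E] (hE : IsLocallyComplete E) (hΩ : IsOpen Ω)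
    (hf : IsWeaklyHolomorphicOn f Ω) (j : Fin d) :
    IsWeaklyHolomorphicOn (cpartial j f) Ω := by
  have happly : ∀ e' : E →L[ℂ] ℂ, ∀ z ∈ Ω,
      e' (LCHolo.cpartial j f z) = LCHolo.cpartial j (fun z => e' (f z)) z := fun e' z hz =>
    apply_cpartial (hf.exists_tendsto_diffQuot hE hΩ j hz) e'
      ((hf.differentiableOn e').differentiableAt (hΩ.mem_nhds hz))
  refine ⟨fun e' => (differentiableOn_cpartial hΩ (hf.differentiableOn e') j).congr (happly e'),
    fun K hK hKc => ?_⟩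
  obtain ⟨δ, hδ, hδΩ⟩ := hKc.exists_cthickening_subset_open hΩ hK
  set B := f '' Metric.cthickening δ K
  have hD := isVonNBounded_bipolar (hf.isVonNBounded _ hδΩ hKc.cthickening)
  -- By the Cauchy estimates the derivatives on `K` lie in a multiple of the bipolar of `B`.
  refine (hD.image ((2 * 1 / δ : ℂ) • ContinuousLinearMap.id ℂ E)).subset ?_
  rintro _ ⟨z, hz, rfl⟩
  have hmem : LCHolo.cpartial j f z ∈ (2 * 1 / δ) • bipolar B := by
    refine (mem_smul_bipolar_iff (by positivity)).2 fun e' he' => ?_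
    rw [happly e' z (hK hz),
      cpartial_eq_fderiv ((hf.differentiableOn e').differentiableAt (hΩ.mem_nhds (hK hz)))]
    have hsub : Metric.ball z δ ⊆ Metric.cthickening δ K :=
      Metric.ball_subset_closedBall.trans (Metric.closedBall_subset_cthickening hz δ)
    have := norm_fderiv_le_of_norm_le_on_ball hδ
      ((hf.differentiableOn e').mono (hsub.trans hδΩ))
      fun y hy => he' _ (mem_image_of_mem f (hsub hy))
    refine (ContinuousLinearMap.le_opNorm _ _).trans ?_
    simpa using this
  obtain ⟨y, hy, hyz⟩ := hmem
  refine ⟨y, hy, ?_⟩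
  rw [← hyz]
  simp [← Complex.coe_smul]

theorem IsWeaklyHolomorphicOn.isCPartialDiffOn [IsTopologicalAddGroup E]
    [ContinuousSMul ℂ E] [LocallyConvexSpace ℝ E] (hE : IsLocallyComplete E) (hΩ : IsOpen Ω)
    (k : ℕ) (hf : IsWeaklyHolomorphicOn f Ω) : IsCPartialDiffOn k f Ω := by
  induction k generalizing f with
  | zero => trivial
  | succ k ih =>
    exact fun j => ⟨fun z hz => hf.exists_tendsto_diffQuot hE hΩ j hz, ih (hf.cpartial hE hΩ j)⟩

/-- Functionals commute with iterated partial derivatives: all intermediate derivatives exist in `E`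
and are weakly holomorphic. -/
theorem IsWeaklyHolomorphicOn.apply_iterCPartial [IsTopologicalAddGroup E]
    [ContinuousSMul ℂ E] [LocallyConvexSpace ℝ E] (hE : IsLocallyComplete E) (hΩ : IsOpen Ω)
    (hf : IsWeaklyHolomorphicOn f Ω) (β : Fin d → ℕ) (e' : E →L[ℂ] ℂ) {z : Cd d} (hz : z ∈ Ω) :
    e' (iterCPartial β f z) = iterCPartial β (fun z => e' (f z)) z := by
  have hiter : ∀ (j : Fin d) (n : ℕ) (g : Cd d → E) (φ : Cd d → ℂ), IsWeaklyHolomorphicOn g Ω →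
      EqOn (fun z => e' (g z)) φ Ω → IsWeaklyHolomorphicOn ((LCHolo.cpartial j)^[n] g) Ω ∧
        EqOn (fun z => e' ((LCHolo.cpartial j)^[n] g z)) ((LCHolo.cpartial j)^[n] φ) Ω := by
    intro j n
    induction n with
    | zero => exact fun g φ hg h => ⟨hg, h⟩
    | succ n ih =>
      intro g φ hg h
      refine ih _ _ (hg.cpartial hE hΩ j) fun y hy => ?_
      rw [← cpartial_congr hΩ h j hy]
      exact apply_cpartial (hg.exists_tendsto_diffQuot hE hΩ j hy) e'
        ((hg.differentiableOn e').differentiableAt (hΩ.mem_nhds hy))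
  have hfold : ∀ l : List (Fin d),
      IsWeaklyHolomorphicOn (l.foldr (fun j g => (LCHolo.cpartial j)^[β j] g) f) Ω ∧
      EqOn (fun z => e' (l.foldr (fun j g => (LCHolo.cpartial j)^[β j] g) f z))
        (l.foldr (fun j g => (LCHolo.cpartial j)^[β j] g) (fun z => e' (f z))) Ω := by
    intro l
    induction l with
    | nil => exact ⟨hf, fun _ _ => rfl⟩
    | cons j l ih => exact hiter j (β j) _ _ ih.1 ih.2
  exact (hfold _).2 hz

end Partial

/-! ### Cauchy's integral formula for scalar functions on a polydisc -/

/-- The point of `ℂᵈ⁺¹` with first coordinate `t` and remaining coordinates `y`. -/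
def consPoint {d : ℕ} (t : ℂ) (y : Cd d) : Cd (d + 1) := WithLp.toLp 2 (Fin.cons t y.ofLp)

section Slices

variable {d : ℕ}

theorem consPoint_zero (t : ℂ) (y : Cd d) : consPoint t y 0 = t := rfl

theorem consPoint_succ (t : ℂ) (y : Cd d) (k : Fin d) : consPoint t y k.succ = y k := rfl

theorem consPoint_add_smul_single_zero (t h : ℂ) (y : Cd d) :
    consPoint t y + h • EuclideanSpace.single 0 (1 : ℂ) = consPoint (t + h) y := by
  ext k
  refine Fin.cases ?_ (fun i => ?_) k
  · simp [consPoint_zero]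
  · simp [consPoint_succ]

theorem consPoint_add_smul_single_succ (t h : ℂ) (y : Cd d) (j : Fin d) :
    consPoint t y + h • EuclideanSpace.single j.succ (1 : ℂ) =
      consPoint t (y + h • EuclideanSpace.single j (1 : ℂ)) := by
  ext k
  refine Fin.cases ?_ (fun i => ?_) k
  · simp [consPoint_zero]
  · simp [consPoint_succ]

theorem differentiable_consPoint_left (y : Cd d) : Differentiable ℂ fun t => consPoint t y := by
  rw [differentiable_euclidean]
  refine Fin.cases ?_ fun i => ?_
  · exact differentiable_id
  · exact differentiable_const _

theorem differentiable_consPoint_right (t : ℂ) :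
    Differentiable ℂ fun y : Cd d => consPoint t y := by
  rw [differentiable_euclidean]
  refine Fin.cases ?_ fun i => ?_
  · exact differentiable_const _
  · exact (by fun_prop : Differentiable ℂ fun y : Cd d => y i)

/-- Derivatives in all coordinates but the first can be computed on the slice on which the first
coordinate is fixed. -/
theorem foldr_map_succ_cpartial (β : Fin (d + 1) → ℕ) (l : List (Fin d)) (φ : Cd (d + 1) → ℂ)
    (t : ℂ) :
    (fun y => (l.map Fin.succ).foldr (fun j g => (cpartial j)^[β j] g) φ (consPoint t y)) =
      l.foldr (fun j g => (cpartial j)^[β j.succ] g) (fun y => φ (consPoint t y)) := by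
  induction l with
  | nil => rfl
  | cons j l ih =>
    have hsemi : Function.Semiconj (fun (g : Cd (d + 1) → ℂ) (y : Cd d) => g (consPoint t y))
        (cpartial j.succ) (cpartial j) := by
      intro g
      funext y
      have hq : diffQuot g j.succ (consPoint t y) =
          diffQuot (fun y => g (consPoint t y)) j y := by
        funext h
        simp only [diffQuot, consPoint_add_smul_single_succ]
      simp only [cpartial, hq]
    simp only [List.map_cons, List.foldr_cons, ← ih]
    exact (hsemi.iterate_right (β j.succ)).eq _

theorem iterate_cpartial_zero {U : Set (Cd (d + 1))} (hU : IsOpen U) (y : Cd d) (n : ℕ) :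
    ∀ g : Cd (d + 1) → ℂ, DifferentiableOn ℂ g U → ∀ t : ℂ, consPoint t y ∈ U →
      (cpartial 0)^[n] g (consPoint t y) = iteratedDeriv n (fun t => g (consPoint t y)) t := by
  induction n with
  | zero => exact fun g _ t _ => by simp
  | succ n ih =>
    intro g hg t ht
    rw [Function.iterate_succ_apply, ih _ (differentiableOn_cpartial hU hg 0) t ht,
      iteratedDeriv_succ']
    refine Filter.EventuallyEq.iteratedDeriv_eq n ?_
    filter_upwards [(hU.preimage (differentiable_consPoint_left y).continuous).mem_nhds ht]
      with s hs
    have hd : DifferentiableAt ℂ (fun t => g (consPoint t y)) s :=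
      DifferentiableAt.comp (g := g) s (hg.differentiableAt (hU.mem_nhds hs))
        (differentiable_consPoint_left y s)
    have := hasDerivAt_iff_tendsto_slope_zero.1 hd.hasDerivAt
    rw [cpartial]
    refine Tendsto.limUnder_eq (this.congr fun h => ?_)
    rw [diffQuot, consPoint_add_smul_single_zero]

end Slices

theorem differentiableOn_foldr_cpartial {d : ℕ} {U : Set (Cd d)} (hU : IsOpen U) {φ : Cd d → ℂ}
    (hφ : DifferentiableOn ℂ φ U) (β : Fin d → ℕ) (l : List (Fin d)) :
    DifferentiableOn ℂ (l.foldr (fun j g => (cpartial j)^[β j] g) φ) U := by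
  induction l with
  | nil => exact hφ
  | cons j l ih =>
    simp only [List.foldr_cons]
    generalize β j = n
    induction n with
    | zero => exact ih
    | succ n ihn =>
      rw [Function.iterate_succ_apply']
      exact differentiableOn_cpartial hU ihn j

/-- The integrand of Cauchy's formula is continuous along the torus. -/
theorem continuous_cauchyIntegrand {d : ℕ} {U : Set (Cd d)} {φ : Cd d → ℂ}
    (hφ : ContinuousOn φ U) {w ζ : Cd d} {ρ : Fin d → ℝ} (hρ : ∀ k, 0 < ρ k)
    (hwU : ∀ z : Cd d, (∀ k, z k ∈ Metric.closedBall (w k) (ρ k)) → z ∈ U)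
    (hζ : ∀ k, ζ k ∈ Metric.ball (w k) (ρ k)) (β : Fin d → ℕ) :
    Continuous fun θ : Fin d → ℝ =>
      (∏ k, (torusMap w.ofLp ρ θ k - ζ k) ^ (β k + 1))⁻¹ *
        φ (WithLp.toLp 2 (torusMap w.ofLp ρ θ)) := by
  have hmap : Continuous (torusMap w.ofLp ρ) := by
    unfold torusMap
    fun_prop
  have hdist : ∀ θ k, dist (torusMap w.ofLp ρ θ k) (w k) = ρ k := fun θ k => by
    rw [dist_eq_norm, torusMap, add_sub_cancel_left, norm_mul, Complex.norm_exp_ofReal_mul_I,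
      Complex.norm_real, Real.norm_of_nonneg (hρ k).le, mul_one]
  refine (Continuous.inv₀ (by fun_prop) fun θ => ?_).mul
    (hφ.comp_continuous ((PiLp.continuous_toLp 2 _).comp hmap) fun θ =>
      hwU _ fun k => Metric.mem_closedBall.2 (hdist θ k).le)
  refine Finset.prod_ne_zero_iff.2 fun k _ => pow_ne_zero _ (sub_ne_zero.2 fun h => ?_)
  have := Metric.mem_ball.1 (hζ k)
  rw [← h, hdist] at this
  exact this.false

/-- **Cauchy's integral formula** on a polydisc, by induction on the dimension: the formula in one
variable is applied to the first coordinate, and its integrand is expanded by the formula in the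
remaining coordinates. -/
theorem iterCPartial_eq_torusIntegral {d : ℕ} :
    ∀ {U : Set (Cd d)}, IsOpen U → ∀ {φ : Cd d → ℂ}, DifferentiableOn ℂ φ U →
    ∀ {w ζ : Cd d} {ρ : Fin d → ℝ}, (∀ k, 0 < ρ k) →
    (∀ z : Cd d, (∀ k, z k ∈ Metric.closedBall (w k) (ρ k)) → z ∈ U) →
    (∀ k, ζ k ∈ Metric.ball (w k) (ρ k)) → ∀ β : Fin d → ℕ,
    iterCPartial β φ ζ = ((∏ k, (β k).factorial : ℕ) / (2 * Real.pi * Complex.I) ^ d : ℂ) *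
      torusIntegral (fun z => (∏ k, (z k - ζ k) ^ (β k + 1))⁻¹ * φ (WithLp.toLp 2 z)) w.ofLp ρ := by
  induction d with
  | zero =>
    intro U hU φ hφ w ζ ρ _ _ _ β
    simp only [torusIntegral_dim0, Finset.univ_eq_empty, Finset.prod_empty, pow_zero, Nat.cast_one,
      div_one, one_mul, inv_one, iterCPartial, List.finRange_zero, List.foldr_nil]
    exact congrArg φ (Subsingleton.elim _ _)
  | succ d ih =>
    intro U hU φ hφ w ζ ρ hρ hwU hζ β
    set w' : Cd d := WithLp.toLp 2 (fun k => w k.succ)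
    set ζ' : Cd d := WithLp.toLp 2 (fun k => ζ k.succ)
    have hζcons : consPoint (ζ 0) ζ' = ζ := by
      ext k
      refine Fin.cases rfl (fun i => rfl) k
    have hmem : ∀ t ∈ Metric.closedBall (w 0) (ρ 0), ∀ y : Cd d,
        (∀ k, y k ∈ Metric.closedBall (w' k) (ρ k.succ)) → consPoint t y ∈ U := fun t ht y hy =>
      hwU _ (Fin.cases ht hy)
    have hζmem : ∀ k, ζ' k ∈ Metric.ball (w' k) (ρ k.succ) := fun k => hζ k.succ
    set G := ((List.finRange d).map Fin.succ).foldr (fun j g => (cpartial j)^[β j] g) φ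
    have hGd : DifferentiableOn ℂ G U := differentiableOn_foldr_cpartial hU hφ β _
    have hGslice : ∀ t, G (consPoint t ζ') =
        iterCPartial (fun k => β k.succ) (fun y => φ (consPoint t y)) ζ' := fun t =>
      congrFun (foldr_map_succ_cpartial β (List.finRange d) φ t) ζ'
    have hstep : iterCPartial β φ ζ = (cpartial 0)^[β 0] G (consPoint (ζ 0) ζ') := by
      rw [hζcons, iterCPartial, List.finRange_succ]
      rfl
    have hcirc := iteratedDeriv_eq_circleIntegral (U := {t | consPoint t ζ' ∈ U})
      (hU.preimage (differentiable_consPoint_left ζ').continuous)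
      (fun t ht => hmem t ht ζ' fun k => Metric.ball_subset_closedBall (hζmem k)) (hζ 0) (β 0)
      (fun t => G (consPoint t ζ'))
      (DifferentiableOn.comp (g := G) (t := U) hGd
        (differentiable_consPoint_left ζ').differentiableOn fun t ht => ht)
    rw [hstep, iterate_cpartial_zero hU ζ' (β 0) G hGd _ (hmem _
      (Metric.ball_subset_closedBall (hζ 0)) ζ' fun k => Metric.ball_subset_closedBall (hζmem k)),
      hcirc, torusIntegral_succ
        ((continuous_cauchyIntegrand hφ.continuousOn hρ hwU hζ β).continuousOn.integrableOn_compact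
          isCompact_Icc)]
    have hinner : ∀ z ∈ Metric.sphere (w 0) (ρ 0),
        ((z - ζ 0) ^ (β 0 + 1))⁻¹ * G (consPoint z ζ') =
          ((∏ k : Fin d, (β k.succ).factorial : ℕ) / (2 * Real.pi * Complex.I) ^ d : ℂ) *
          torusIntegral (fun y => (∏ k, ((Fin.cons z y : Fin (d + 1) → ℂ) k - ζ k) ^ (β k + 1))⁻¹ *
            φ (WithLp.toLp 2 (Fin.cons z y))) (w.ofLp ∘ Fin.succ) (ρ ∘ Fin.succ) := by
      intro z hz
      have hz' := Metric.sphere_subset_closedBall hz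
      rw [hGslice, ih (U := {y | consPoint z y ∈ U}) (φ := fun y => φ (consPoint z y))
        (w := w') (ρ := fun k => ρ k.succ)
        (hU.preimage (differentiable_consPoint_right z).continuous)
        (DifferentiableOn.comp (g := φ) (t := U) hφ
          (differentiable_consPoint_right z).differentiableOn fun t ht => ht)
        (fun k => hρ k.succ) (fun y hy => hmem z hz' y hy) hζmem, mul_left_comm,
        ← torusIntegral_const_mul]
      congr 1
      refine congrArg (fun F => torusIntegral F _ _) (funext fun y => ?_)
      rw [Fin.prod_univ_succ, mul_inv, mul_assoc]
      rfl
    rw [circleIntegral.integral_congr (hρ 0).le hinner, circleIntegral.integral_const_mul,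
      Fin.prod_univ_succ]
    push_cast
    rw [← mul_assoc]
    congr 1
    rw [pow_succ]
    field_simp

/-- The integral over the distinguished boundary, expressed through the torus integrals of the
scalar integrands. -/
theorem hasDistinguishedBoundaryIntegral_iff {d : ℕ} {E : Type*} [AddCommGroup E] [Module ℂ E]
    [TopologicalSpace E] {f : Cd d → E} {w ζ : Cd d} {ρ : Fin d → ℝ} {β : Fin d → ℕ} {J : E} :
    HasDistinguishedBoundaryIntegral w ρ (fun z => (∏ k, (z k - ζ k) ^ (β k + 1))⁻¹ • f z) J ↔
    ∀ e' : E →L[ℂ] ℂ,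
      IntegrableOn (fun θ : Fin d → ℝ =>
        (∏ k, ρ k * Complex.exp (θ k * Complex.I) * Complex.I : ℂ) *
          ((∏ k, (torusMap w.ofLp ρ θ k - ζ k) ^ (β k + 1))⁻¹ *
        e' (f (WithLp.toLp 2 (torusMap w.ofLp ρ θ))))) (Icc 0 fun _ => 2 * Real.pi) ∧
      e' J = torusIntegral (fun z => (∏ k, (z k - ζ k) ^ (β k + 1))⁻¹ * e' (f (WithLp.toLp 2 z)))
        w.ofLp ρ := by
  refine forall_congr' fun e' => ?_
  have : (fun t : Fin d → ℝ => e' ((∏ k, deriv (circleMap (w k) (ρ k)) (t k)) •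
      (∏ k, (circleMap (w k) (ρ k) (t k) - ζ k) ^ (β k + 1))⁻¹ •
        f (WithLp.toLp 2 fun k => circleMap (w k) (ρ k) (t k)))) =
      fun θ : Fin d → ℝ => (∏ k, ρ k * Complex.exp (θ k * Complex.I) * Complex.I : ℂ) *
        ((∏ k, (torusMap w.ofLp ρ θ k - ζ k) ^ (β k + 1))⁻¹ *
        e' (f (WithLp.toLp 2 (torusMap w.ofLp ρ θ)))) := by
    funext t
    simp only [deriv_circleMap, circleMap_zero, map_smul, smul_eq_mul]
    rfl
  rw [this]
  rfl

end LCHolo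

theorem mainTheorem2 {E : Type*} [AddCommGroup E] [Module ℂ E] [UniformSpace E]
    [IsUniformAddGroup E] [ContinuousSMul ℂ E] [LocallyConvexSpace ℝ E] [T2Space E]
    (hE : LCHolo.IsLocallyComplete E)
    {d : ℕ} (Ω : Set (LCHolo.Cd d)) (hΩ : IsOpen Ω)
    (w : LCHolo.Cd d) (R : Fin d → ℝ≥0∞) (hR : ∀ k, 0 < R k) (hRΩ : LCHolo.polydisc w R ⊆ Ω)
    (f : LCHolo.Cd d → E) (hf : LCHolo.IsHolomorphicOn f Ω) :
    (∀ k : ℕ, LCHolo.IsCPartialDiffOn k f Ω) ∧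
    ∀ ρ : Fin d → ℝ, (∀ k, 0 < ρ k) → (∀ k, ENNReal.ofReal (ρ k) < R k) →
      ∀ ζ ∈ LCHolo.polydisc w (fun k => ENNReal.ofReal (ρ k)), ∀ β : Fin d → ℕ,
        ∃ J : E,
          LCHolo.HasDistinguishedBoundaryIntegral w ρ
            (fun z => (∏ k, (z k - ζ k) ^ (β k + 1))⁻¹ • f z) J ∧
          LCHolo.iterCPartial β f ζ =
            ((∏ k, (β k).factorial : ℕ) / (2 * Real.pi * Complex.I) ^ d : ℂ) • J := by
  have hW := hf.isWeaklyHolomorphicOn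
  refine ⟨fun k => hW.isCPartialDiffOn hE hΩ k, fun ρ hρ hρR ζ hζ β => ?_⟩
  have hwΩ : ∀ z : LCHolo.Cd d, (∀ k, z k ∈ Metric.closedBall (w k) (ρ k)) → z ∈ Ω :=
    fun z hz => hRΩ fun k => lt_of_le_of_lt
      (by rw [edist_dist]; exact ENNReal.ofReal_le_ofReal (hz k)) (hρR k)
  have hζ' : ∀ k, ζ k ∈ Metric.ball (w k) (ρ k) := fun k => by
    have := hζ k
    rw [edist_dist] at this
    exact (ENNReal.ofReal_lt_ofReal_iff (hρ k)).1 this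
  set c : ℂ := (∏ k, (β k).factorial : ℕ) / (2 * Real.pi * Complex.I) ^ d with hc
  have hc0 : c ≠ 0 := by
    refine div_ne_zero (Nat.cast_ne_zero.2 (Finset.prod_ne_zero_iff.2 fun k _ =>
      Nat.factorial_ne_zero _)) (pow_ne_zero _ Complex.two_pi_I_ne_zero)
  refine ⟨c⁻¹ • LCHolo.iterCPartial β f ζ, ?_, (smul_inv_smul₀ hc0 _).symm⟩
  refine LCHolo.hasDistinguishedBoundaryIntegral_iff.2 fun e' => ⟨?_, ?_⟩
  · refine (Continuous.mul (by fun_prop) (LCHolo.continuous_cauchyIntegrand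
      (hW.differentiableOn e').continuousOn hρ hwΩ hζ' β)).continuousOn.integrableOn_compact
      isCompact_Icc
  · rw [map_smul, hW.apply_iterCPartial hE hΩ β e' (hwΩ ζ fun k =>
      Metric.ball_subset_closedBall (hζ' k)), smul_eq_mul,
      LCHolo.iterCPartial_eq_torusIntegral hΩ (hW.differentiableOn e') hρ hwΩ hζ' β, ← hc,
      inv_mul_cancel_left₀ hc0]
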